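/- Let $0<p<1$ and $q=1-p$. Let $X_1,X_2,\dots$ be independent random variables, uniformly distributed on $[0,1]$, and let $N$ be a random variable, independent of the sequence $(X_i)$, with $\mathbf P(N=k)=pq^{k-1}$ for $k=1,2,\dots$. The $k$-th object has value $X_k$ and is available iff $k\le N$. At stage $k$ the decision maker knows $X_1,\dots,X_k$ and the indicators of the events $\{N\ge 1\},\dots,\{N\ge k\}$; stopping times $\tau$ (with values in $\{1,2,\dots\}\cup\{\infty\}$) are taken with respect to this filtration. A candidate is a relative maximum, i.e. an object $k$ with $X_k=\max\{X_1,\dots,X_k\}$. For $1\le k\le N$ and $x\in[0,1]$ let $$D_k(x)=1+\sum_{i=k+1}^{N}\prod_{j=k+1}^{i}\mathbf 1_{\{X_j<x\}}$$ be the duration for which a candidate of value $x$ selected at stage $k$ is held. The payoff of $\tau$ is $D_\tau(X_\tau)$ if $\tau\le N$ and object $\tau$ is a candidate, and $0$ otherwise. Let $v^\star$ be the supremum of the expected payoff over all stopping times; a stopping time is optimal if it attains $v^\star$. A state is a pair $(k,x)$ with $k\ge1$ and $x\in[0,1]$, meaning that $N\ge k$ and that object $k$ is a candidate of value $x$. Let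 $s_k(x)=\mathbf E[D_k(x)\mid N\ge k]$ be the expected payoff of stopping in state $(k,x)$. Let $c_k(x)$ be the supremum, over stopping times $\tau>k$, of the conditional expectation given $N\ge k$ of the payoff of $\tau$ when the running maximum at stage $k$ is $x$ (so that object $j>k$ is a candidate iff $X_j\ge\max\{x,X_{k+1},\dots,X_j\}$). The optimal stopping region is the set of states with $s_k(x)\ge c_k(x)$. (i) If $p\le e^{-1}$, put $x_0=\frac{1-ep}{q}$. Then $0\le x_0<1$, with $x_0>0$ if $p<e^{-1}$; the optimal stopping region is $\{(k,x): x\ge x_0\}$; the rule that selects the first available candidate of value at least $x_0$ is an optimal stopping time; and $$v^\star=\frac{x_0}{1-qx_0}-\frac1q\ln\frac{1-q}{1-qx_0}.$$ (ii) If $p>e^{-1}$, the optimal stopping region is the whole state space, stopping at the first observation is optimal, and $$v^\star=-\frac1q\ln(1-q).$$ -/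

import Mathlib

open MeasureTheory ProbabilityTheory
open scoped ENNReal

noncomputable section

namespace GeomDuration

variable {Ω : Type*} [MeasurableSpace Ω]

/-- The objects are indexed from `0`: `X i` is the value of the `(i+1)`-st object, and this object
is available iff `i < N`, where `N` is the (random) number of objects.

`info` is the information available to the decision maker: at stage `i` the values
`X 0, …, X i` and the indicators of the events "object `j` is available", `j ≤ i`, are known. -/
def info (X : ℕ → Ω → ℝ) (N : Ω → ℕ) (hX : ∀ i, Measurable (X i)) (hN : Measurable N) :
    Filtration ℕ (inferInstance : MeasurableSpace Ω) :=
  Filtration.natural (fun i ω => (X i ω, if i < N ω then (1 : ℝ) else 0)) fun i =>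
    ((hX i).prodMk (Measurable.ite (hN measurableSet_Ioi) measurable_const
      measurable_const)).stronglyMeasurable

/-- Object `i` is a candidate (a relative maximum). -/
def IsCandidate (X : ℕ → Ω → ℝ) (i : ℕ) (ω : Ω) : Prop := ∀ j ≤ i, X j ω ≤ X i ω

open Classical in
/-- The time during which an available candidate of value `x` at stage `i` is held: until the
first larger value or until the last stage of the horizon, i.e.
`1 + ∑_{i < j < N} ∏_{i < l ≤ j} 1{X_l < x}`. -/
def duration (X : ℕ → Ω → ℝ) (N : Ω → ℕ) (i : ℕ) (x : ℝ) (ω : Ω) : ℝ≥0∞ :=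
  1 + ∑ j ∈ Finset.Ioo i (N ω), ∏ l ∈ Finset.Ioc i j, if X l ω < x then 1 else 0

open Classical in
/-- The payoff of a stopping rule `τ`: the duration of the selected object if that object is an
available candidate; `0` if it is not, or if `τ` never stops. -/
def payoff (X : ℕ → Ω → ℝ) (N : Ω → ℕ) (τ : Ω → WithTop ℕ) (ω : Ω) : ℝ≥0∞ :=
  WithTop.recTopCoe 0
    (fun i => if i < N ω ∧ IsCandidate X i ω then duration X N i (X i ω) ω else 0) (τ ω)

/-- The value of the problem: the supremum of the expected payoff over all stopping times. -/
def value (P : Measure Ω) (X : ℕ → Ω → ℝ) (N : Ω → ℕ)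
    (hX : ∀ i, Measurable (X i)) (hN : Measurable N) : ℝ≥0∞ :=
  ⨆ (τ : Ω → WithTop ℕ) (_ : IsStoppingTime (info X N hX hN) τ), ∫⁻ ω, payoff X N τ ω ∂P

/-- `τ` is an optimal stopping time. -/
def IsOptimal (P : Measure Ω) (X : ℕ → Ω → ℝ) (N : Ω → ℕ)
    (hX : ∀ i, Measurable (X i)) (hN : Measurable N) (τ : Ω → WithTop ℕ) : Prop :=
  IsStoppingTime (info X N hX hN) τ ∧ ∫⁻ ω, payoff X N τ ω ∂P = value P X N hX hN

/-- `s_k(x)`: the expected payoff of stopping in state `(k, x)`, i.e. when object `k` is available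
and is a candidate of value `x`. -/
def stopValue (P : Measure Ω) (X : ℕ → Ω → ℝ) (N : Ω → ℕ) (k : ℕ) (x : ℝ) : ℝ≥0∞ :=
  ∫⁻ ω, duration X N k x ω ∂P[|{ω | k < N ω}]

open Classical in
/-- The payoff of a rule `τ` that passes over the candidate in state `(k, x)`. The largest value up
to stage `k` being `x`, a later object `j` is a candidate iff its value is at least `x` and at least
the values at the stages in `(k, j]`. -/
def contPayoff (X : ℕ → Ω → ℝ) (N : Ω → ℕ) (k : ℕ) (x : ℝ) (τ : Ω → WithTop ℕ) (ω : Ω) : ℝ≥0∞ :=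
  WithTop.recTopCoe 0
    (fun j => if j < N ω ∧ x ≤ X j ω ∧ (∀ l, k < l → l ≤ j → X l ω ≤ X j ω) then
      duration X N j (X j ω) ω else 0) (τ ω)

/-- `c_k(x)`: the optimal expected payoff of continuing from state `(k, x)`. -/
def contValue (P : Measure Ω) (X : ℕ → Ω → ℝ) (N : Ω → ℕ)
    (hX : ∀ i, Measurable (X i)) (hN : Measurable N) (k : ℕ) (x : ℝ) : ℝ≥0∞ :=
  ⨆ (τ : Ω → WithTop ℕ) (_ : IsStoppingTime (info X N hX hN) τ ∧ ∀ ω, (k : WithTop ℕ) < τ ω),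
    ∫⁻ ω, contPayoff X N k x τ ω ∂P[|{ω | k < N ω}]

/-- The states `(k, x)`: stage and value of the current candidate. -/
def states : Set (ℕ × ℝ) := {s | s.2 ∈ Set.Icc (0 : ℝ) 1}

/-- The optimal stopping region: the states in which stopping is at least as good as continuing
in an optimal manner. -/
def stoppingRegion (P : Measure Ω) (X : ℕ → Ω → ℝ) (N : Ω → ℕ)
    (hX : ∀ i, Measurable (X i)) (hN : Measurable N) : Set (ℕ × ℝ) :=
  {s ∈ states | contValue P X N hX hN s.1 s.2 ≤ stopValue P X N s.1 s.2}

open Classical in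
/-- The rule: select the first available candidate of value at least `a` (never stop if there is
none). -/
def threshold (X : ℕ → Ω → ℝ) (N : Ω → ℕ) (a : ℝ) (ω : Ω) : WithTop ℕ :=
  if h : ∃ i, i < N ω ∧ IsCandidate X i ω ∧ a ≤ X i ω then ((Nat.find h : ℕ) : WithTop ℕ) else ⊤

end GeomDuration

end

/-!
Since the horizon is geometric, it acts as a discount factor `Q`: while objects are available, a
stopping time is a rule that looks at the values only, and object `n` is available with probability
`Q ^ n`, independently of the values. So an available candidate of value `x` is held for a geometric
time of mean `s x = 1 / (1 - Q μ(-∞, x))`, where `μ` is the law of the values, and waiting for the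
first object of value at least `b` is worth `U b = s b * T b`, where `T b` is the integral of `s`
over `[b, ∞)`. Passing over a candidate of value `x` in order to select the next candidate gains
`Q U x = s x * (Q T x)`, which is at most `s x` iff `Q T x ≤ 1`. As `T` is antitone, this suggests
to stop from the level `a` on at which `Q T a = 1`, or always, if `Q T ≤ 1` throughout.

For optimality, let `Z n` be the maximum of `a` and the values seen before stage `n`. Then `U (Z n)`
bounds the expected future payoff: averaged over the next value `y`, it is exactly the value of
waiting, and it dominates both `s y` for an eligible `y` and `Q U (max (Z n) y)`. These one-step
inequalities telescope along every stopping time. For the uniform law on `[0, 1]` all the integrals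
are explicit, and `Q T a = 1` becomes `1 - q a = e (1 - q)`.
-/

namespace GeomDuration

open Set Function

section Values

variable {μ : Measure ℝ} {Q : ℝ≥0∞} {a b x : ℝ}

/-- The mean duration of an available candidate of value `x`, when the values have law `μ` and each
object is followed by another one with probability `Q`. -/
noncomputable def meanDuration (μ : Measure ℝ) (Q : ℝ≥0∞) (x : ℝ) : ℝ≥0∞ := (1 - Q * μ (Iio x))⁻¹

/-- The mean duration of an available object, counted as zero when its value is below `a`. -/
noncomputable def tailDuration (μ : Measure ℝ) (Q : ℝ≥0∞) (a : ℝ) : ℝ≥0∞ :=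
  ∫⁻ y in Ici a, meanDuration μ Q y ∂μ

/-- The expected payoff, from a stage that is available, of the rule selecting the first available
object of value at least `b`. -/
noncomputable def passageValue (μ : Measure ℝ) (Q : ℝ≥0∞) (b : ℝ) : ℝ≥0∞ :=
  meanDuration μ Q b * tailDuration μ Q b

open Classical in
/-- The expected payoff of the rule selecting the first available object of value at least `b`, once
the next object has been seen to be available and of value `y`. -/
noncomputable def stepValue (μ : Measure ℝ) (Q : ℝ≥0∞) (b y : ℝ) : ℝ≥0∞ :=
  if y < b then Q * passageValue μ Q b else meanDuration μ Q y

lemma measurable_measure_Iio (μ : Measure ℝ) : Measurable fun x => μ (Iio x) :=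
  Monotone.measurable fun _ _ h => measure_mono (Iio_subset_Iio h)

lemma monotone_meanDuration : Monotone (meanDuration μ Q) := fun _ _ h => by
  unfold meanDuration
  gcongr

lemma antitone_tailDuration : Antitone (tailDuration μ Q) := fun _ _ h =>
  lintegral_mono_set (Ici_subset_Ici.mpr h)

@[fun_prop]
lemma measurable_meanDuration : Measurable (meanDuration μ Q) := monotone_meanDuration.measurable

@[fun_prop]
lemma measurable_passageValue : Measurable (passageValue μ Q) :=
  measurable_meanDuration.mul antitone_tailDuration.measurable

lemma measurable_uncurry_stepValue : Measurable (uncurry (stepValue μ Q)) :=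
  Measurable.ite (measurableSet_lt measurable_snd measurable_fst) (by fun_prop) (by fun_prop)

lemma meanDuration_eq_one_add (μ : Measure ℝ) (Q : ℝ≥0∞) (x : ℝ) :
    meanDuration μ Q x = 1 + Q * μ (Iio x) * meanDuration μ Q x := by
  simp only [meanDuration, ← ENNReal.tsum_geometric, ← ENNReal.tsum_mul_left]
  simpa only [pow_zero, pow_succ'] using
    tsum_eq_zero_add' (f := fun n => (Q * μ (Iio x)) ^ n) ENNReal.summable

lemma lintegral_stepValue (μ : Measure ℝ) (Q : ℝ≥0∞) (b : ℝ) :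
    ∫⁻ y, stepValue μ Q b y ∂μ = passageValue μ Q b := by
  have hsplit : stepValue μ Q b = fun y => (Iio b).indicator (fun _ => Q * passageValue μ Q b) y +
      (Ici b).indicator (meanDuration μ Q) y := by
    ext y
    rcases lt_or_ge y b with hy | hy
    · simp [stepValue, hy]
    · simp [stepValue, hy, hy.not_gt]
  calc ∫⁻ y, stepValue μ Q b y ∂μ
      = Q * passageValue μ Q b * μ (Iio b) + tailDuration μ Q b := by
        rw [hsplit, lintegral_add_left (measurable_const.indicator measurableSet_Iio),
          lintegral_indicator_const measurableSet_Iio, lintegral_indicator measurableSet_Ici,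
          tailDuration]
    _ = (1 + Q * μ (Iio b) * meanDuration μ Q b) * tailDuration μ Q b := by
        rw [passageValue]; ring
    _ = passageValue μ Q b := by rw [← meanDuration_eq_one_add, passageValue]

/-- The level `a` separates the values at which a candidate is passed over from those at which it is
selected: above `a` the mean duration dominates the value of waiting for a larger object, while
below `a` it is dominated by the value of waiting for an object of value at least `a`. -/
structure IsOptimalLevel (μ : Measure ℝ) (Q : ℝ≥0∞) (a : ℝ) : Prop where
  mul_tailDuration_le_one : Q * tailDuration μ Q a ≤ 1
  meanDuration_le : ∀ᵐ y ∂μ, y < a → meanDuration μ Q y ≤ Q * passageValue μ Q a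

lemma mul_passageValue_of_mul_tailDuration_eq_one (h : Q * tailDuration μ Q a = 1) :
    Q * passageValue μ Q a = meanDuration μ Q a := by
  rw [passageValue, mul_left_comm, h, mul_one]

lemma passageValue_of_measure_Iio_eq_zero (ha : μ (Iio a) = 0) :
    passageValue μ Q a = ∫⁻ y, meanDuration μ Q y ∂μ := by
  rw [passageValue, tailDuration, meanDuration, ha, mul_zero, tsub_zero, inv_one, one_mul,
    Measure.restrict_eq_self_of_ae_mem]
  filter_upwards [measure_eq_zero_iff_ae_notMem.mp ha] with y hy
  exact mem_Ici.mpr (not_lt.mp hy)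

namespace IsOptimalLevel

lemma of_mul_tailDuration_eq_one (h : Q * tailDuration μ Q a = 1) : IsOptimalLevel μ Q a where
  mul_tailDuration_le_one := h.le
  meanDuration_le := .of_forall fun y hy => by
    rw [mul_passageValue_of_mul_tailDuration_eq_one h]
    exact monotone_meanDuration hy.le

lemma of_measure_Iio_eq_zero (hle : Q * tailDuration μ Q a ≤ 1) (ha : μ (Iio a) = 0) :
    IsOptimalLevel μ Q a where
  mul_tailDuration_le_one := hle
  meanDuration_le := by
    filter_upwards [measure_eq_zero_iff_ae_notMem.mp ha] with y hy hya
    exact absurd hya hy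

lemma mul_passageValue_le (h : IsOptimalLevel μ Q a) (hx : a ≤ x) :
    Q * passageValue μ Q x ≤ meanDuration μ Q x :=
  calc Q * passageValue μ Q x = meanDuration μ Q x * (Q * tailDuration μ Q x) := by
        rw [passageValue, mul_left_comm]
    _ ≤ meanDuration μ Q x * (Q * tailDuration μ Q a) := by
        gcongr
        exact antitone_tailDuration hx
    _ ≤ meanDuration μ Q x := mul_le_of_le_one_right' h.mul_tailDuration_le_one

lemma mul_passageValue_max_le_stepValue (h : IsOptimalLevel μ Q a) (hb : a ≤ b) (y : ℝ) :
    Q * passageValue μ Q (max b y) ≤ stepValue μ Q b y := by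
  rcases lt_or_ge y b with hy | hy
  · rw [stepValue, if_pos hy, max_eq_left hy.le]
  · rw [stepValue, if_neg hy.not_gt, max_eq_right hy]
    exact h.mul_passageValue_le (hb.trans hy)

lemma ae_meanDuration_le_stepValue (h : IsOptimalLevel μ Q a) :
    ∀ᵐ y ∂μ, ∀ b, a ≤ b → b ≤ max a y → meanDuration μ Q y ≤ stepValue μ Q b y := by
  filter_upwards [h.meanDuration_le] with y hy b hab hb
  rcases lt_or_ge y b with hyb | hyb
  · obtain hba | hby := le_max_iff.mp hb
    · obtain rfl : b = a := hba.antisymm hab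
      rw [stepValue, if_pos hyb]
      exact hy hyb
    · exact absurd hyb hby.not_gt
  · rw [stepValue, if_neg hyb.not_gt]

end IsOptimalLevel

end Values

section Past

variable {Ω : Type*} {X : ℕ → Ω → ℝ} {N : Ω → ℕ} {i k m n : ℕ}

/-- The σ-algebra generated by the values of the objects `i < n`. In contrast to `info`, it does not
know how many objects are available. -/
abbrev past (X : ℕ → Ω → ℝ) (n : ℕ) : MeasurableSpace Ω :=
  ⨆ i ∈ Iio n, MeasurableSpace.comap (X i) inferInstance

lemma measurable_past (h : i < n) : Measurable[past X n] (X i) :=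
  (comap_measurable (X i)).mono
    (le_iSup₂ (f := fun i (_ : i ∈ Iio n) => MeasurableSpace.comap (X i) _) i h) le_rfl

lemma past_mono (h : m ≤ n) : past X m ≤ past X n := biSup_mono fun _ hi => lt_of_lt_of_le hi h

lemma past_le_comap (X : ℕ → Ω → ℝ) (n : ℕ) :
    past X n ≤ MeasurableSpace.comap (fun ω i => X i ω) inferInstance :=
  iSup₂_le fun i _ =>
    Measurable.comap_le ((measurable_pi_apply i).comp (comap_measurable fun ω i => X i ω))

lemma measurableSet_forall_lt {Y : Ω → ℝ} (hY : Measurable[past X k] Y) (n : ℕ) :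
    MeasurableSet[past X (k + n)] {ω | ∀ l ∈ Finset.Ico k (k + n), X l ω < Y ω} := by
  simp only [ofPred_forall]
  exact Finset.measurableSet_biInter _ fun l hl => measurableSet_lt
    (measurable_past (Finset.mem_Ico.mp hl).2) (hY.mono (past_mono (Nat.le_add_right k n)) le_rfl)

variable [mΩ : MeasurableSpace Ω]

lemma past_le (hX : ∀ i, Measurable (X i)) (n : ℕ) : past X n ≤ mΩ :=
  iSup₂_le fun i _ => (hX i).comap_le

lemma measurable_info (hX : ∀ i, Measurable (X i)) (hN : Measurable N) (h : i ≤ n) :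
    Measurable[info X N hX hN n] fun ω => (X i ω, if i < N ω then (1 : ℝ) else 0) :=
  (comap_measurable _).mono
    (le_iSup₂ (f := fun i (_ : i ≤ n) => MeasurableSpace.comap
      (fun ω => (X i ω, if i < N ω then (1 : ℝ) else 0)) _) i h) le_rfl

-- While object `i` is available all the indicators known at stage `i` equal `1`, so that the
-- information consists of the values alone.
lemma exists_measurableSet_past (hX : ∀ i, Measurable (X i)) (hN : Measurable N) {A : Set Ω}
    (hA : MeasurableSet[info X N hX hN i] A) :
    ∃ B, MeasurableSet[past X (i + 1)] B ∧ ∀ ω, i < N ω → (ω ∈ B ↔ ω ∈ A) := by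
  let available : {ω // i < N ω} → Ω := Subtype.val
  have hmeas : Measurable[(past X (i + 1)).comap available, info X N hX hN i] available := by
    rw [measurable_iff_comap_le]
    refine (MeasurableSpace.comap_iSup).trans_le (iSup_le fun j => ?_)
    refine (MeasurableSpace.comap_iSup).trans_le (iSup_le fun hj => ?_)
    rw [MeasurableSpace.comap_comp, ← measurable_iff_comap_le]
    have hlast : (fun ω => (X j ω, if j < N ω then (1 : ℝ) else 0)) ∘ available =
        fun ω => (X j (available ω), 1) :=
      funext fun ω => by simp [available, hj.trans_lt ω.2]
    rw [hlast]
    exact ((measurable_past (Nat.lt_succ_of_le hj)).comp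
      (comap_measurable available)).prodMk measurable_const
  obtain ⟨B, hB, hBA⟩ := hmeas hA
  exact ⟨B, hB, fun ω hω => Set.ext_iff.mp hBA ⟨ω, hω⟩⟩

lemma exists_disjoint_past_of_isStoppingTime {hX : ∀ i, Measurable (X i)} {hN : Measurable N}
    {τ : Ω → WithTop ℕ} (hτ : IsStoppingTime (info X N hX hN) τ) :
    ∃ B : ℕ → Set Ω, (∀ i, MeasurableSet[past X (i + 1)] (B i)) ∧ Pairwise (Disjoint on B) ∧
      ∀ i ω, i < N ω → (ω ∈ B i ↔ τ ω = i) := by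
  choose B hB hBτ using fun i => exists_measurableSet_past hX hN (hτ.measurableSet_eq i)
  refine ⟨disjointed B, fun i => ?_, disjoint_disjointed B, fun i ω hi => ?_⟩
  · rw [disjointed_eq_inter_compl]
    exact (hB i).inter (MeasurableSet.biInter (to_countable _) fun j hj =>
      (past_mono (Nat.succ_le_succ (le_of_lt hj)) _ (hB j)).compl)
  · simp only [disjointed_eq_inter_compl, mem_inter_iff, mem_iInter, mem_compl_iff, hBτ i ω hi]
    refine and_iff_left_of_imp fun hτi j hj => ?_
    rw [hBτ j ω (hj.trans hi)]
    exact fun hτj => hj.ne (WithTop.coe_injective (hτj.symm.trans hτi))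

end Past

section Duration

variable {Ω : Type*} {X : ℕ → Ω → ℝ} {N : Ω → ℕ} {k : ℕ} {ω : Ω}

lemma duration_eq_tsum (hk : k < N ω) (x : ℝ) :
    duration X N k x ω = ∑' n,
      {n | k + n < N ω ∧ ∀ l ∈ Finset.Ico (k + 1) (k + 1 + n), X l ω < x}.indicator 1 n := by
  have hvanish (n : ℕ) (hn : n ∉ Finset.range (N ω - (k + 1) + 1)) :
      n ∉ {n | k + n < N ω ∧ ∀ l ∈ Finset.Ico (k + 1) (k + 1 + n), X l ω < x} := by
    rw [Finset.mem_range] at hn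
    rw [mem_ofPred_eq]
    omega
  have hIoo : Finset.Ioo k (N ω) = Finset.Ico (k + 1) (N ω) := rfl
  rw [tsum_eq_sum fun n hn => indicator_of_notMem (hvanish n hn) 1, Finset.sum_range_succ',
    add_comm, duration, hIoo, Finset.sum_Ico_eq_sum_range]
  congr 1
  · refine (indicator_of_mem ?_ 1).symm
    exact ⟨hk, fun l hl => by simp at hl⟩
  · refine Finset.sum_congr rfl fun n hn => ?_
    have hn' : k + (n + 1) < N ω := by
      rw [Finset.mem_range] at hn
      omega
    have hIoc : Finset.Ioc k (k + 1 + n) = Finset.Ico (k + 1) (k + 1 + (n + 1)) := by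
      ext l
      simp only [Finset.mem_Ioc, Finset.mem_Ico]
      omega
    rw [Finset.prod_ite_zero, Finset.prod_const_one, hIoc]
    simp only [indicator_apply, mem_ofPred_eq, hn', true_and, Pi.one_apply]

end Duration

section Independence

variable {Ω : Type*} [MeasurableSpace Ω] {P : Measure Ω} {X : ℕ → Ω → ℝ} {N : Ω → ℕ}
  {μ : Measure ℝ} {Q : ℝ≥0∞} {k l m : ℕ} {A B : Set Ω} {Y Z : Ω → ℝ}

lemma lintegral_comp_of_indepFun {β γ : Type*} [MeasurableSpace β] [MeasurableSpace γ]
    [IsFiniteMeasure P] {Z : Ω → β} {Y : Ω → γ} (h : IndepFun Z Y P) (hZ : Measurable Z)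
    (hY : Measurable Y) {f : β → γ → ℝ≥0∞} (hf : Measurable (uncurry f)) :
    ∫⁻ ω, f (Z ω) (Y ω) ∂P = ∫⁻ ω, ∫⁻ y, f (Z ω) y ∂P.map Y ∂P :=
  calc ∫⁻ ω, f (Z ω) (Y ω) ∂P = ∫⁻ u, uncurry f u ∂P.map fun ω => (Z ω, Y ω) :=
        (lintegral_map hf (hZ.prodMk hY)).symm
    _ = ∫⁻ z, ∫⁻ y, f z y ∂P.map Y ∂P.map Z := by
        rw [h.map_prod_eq_prod_map_map hZ.aemeasurable hY.aemeasurable,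
          lintegral_prod _ hf.aemeasurable]
        rfl
    _ = ∫⁻ ω, ∫⁻ y, f (Z ω) y ∂P.map Y ∂P := lintegral_map hf.lintegral_prod_right' hZ

/-- The values `X i` are independent with common law `μ`, and independently of them the number `N`
of available objects is geometric: object `n` is available with probability `Q ^ n`. -/
structure IIDGeometricHorizon (P : Measure Ω) (X : ℕ → Ω → ℝ) (N : Ω → ℕ) (μ : Measure ℝ)
    (Q : ℝ≥0∞) : Prop where
  measurable_value : ∀ i, Measurable (X i)
  measurable_horizon : Measurable N
  map_value : ∀ i, P.map (X i) = μ
  iIndepFun_value : iIndepFun X P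
  indepFun_horizon_value : IndepFun N (fun ω i => X i ω) P
  measure_lt_horizon : ∀ n, P {ω | n < N ω} = Q ^ n

namespace IIDGeometricHorizon

lemma isProbabilityMeasure (M : IIDGeometricHorizon P X N μ Q) : IsProbabilityMeasure P :=
  M.iIndepFun_value.isProbabilityMeasure

lemma continuation_le_one (M : IIDGeometricHorizon P X N μ Q) : Q ≤ 1 := by
  have := M.isProbabilityMeasure
  simpa [M.measure_lt_horizon] using prob_le_one (μ := P) (s := {ω | 1 < N ω})

lemma measurableSet_available (M : IIDGeometricHorizon P X N μ Q) (n : ℕ) :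
    MeasurableSet {ω | n < N ω} :=
  M.measurable_horizon measurableSet_Ioi

lemma measure_available_inter (M : IIDGeometricHorizon P X N μ Q) (n : ℕ)
    (hA : MeasurableSet[past X m] A) : P ({ω | n < N ω} ∩ A) = Q ^ n * P A := by
  rw [← M.measure_lt_horizon]
  exact M.indepFun_horizon_value.meas_inter ⟨Ioi n, measurableSet_Ioi, rfl⟩
    (past_le_comap X m A hA)

lemma indep_past_comap (M : IIDGeometricHorizon P X N μ Q) (l : ℕ) :
    Indep (past X l) (MeasurableSpace.comap (X l) inferInstance) P := by
  have h := indep_iSup_of_disjoint (fun i => (M.measurable_value i).comap_le) M.iIndepFun_value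
    (disjoint_singleton_right.mpr (self_notMem_Iio (a := l)))
  rwa [iSup_singleton] at h

lemma setLIntegral_next (M : IIDGeometricHorizon P X N μ Q) (hA : MeasurableSet[past X l] A)
    (hZ : Measurable[past X l] Z) {f : ℝ → ℝ → ℝ≥0∞} (hf : Measurable (uncurry f)) :
    ∫⁻ ω in A, f (Z ω) (X l ω) ∂P = ∫⁻ ω in A, ∫⁻ y, f (Z ω) y ∂μ ∂P := by
  have := M.isProbabilityMeasure
  have hpast := past_le M.measurable_value l
  let mark : Ω → ℝ≥0∞ × ℝ := fun ω => (A.indicator (fun _ => 1) ω, Z ω)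
  have hmark : Measurable[past X l] mark := (measurable_const.indicator hA).prodMk hZ
  have hindep : IndepFun mark (X l) P :=
    indep_of_indep_of_le_left (M.indep_past_comap l) hmark.comap_le
  have h := lintegral_comp_of_indepFun hindep (hmark.mono hpast le_rfl) (M.measurable_value l)
    (f := fun u y => u.1 * f u.2 y)
    ((measurable_fst.comp measurable_fst).mul (hf.comp
      ((measurable_snd.comp measurable_fst).prodMk measurable_snd)))
  rw [← lintegral_indicator (hpast A hA), ← lintegral_indicator (hpast A hA)]
  convert h using 3 with ω ω
  · by_cases hω : ω ∈ A <;> simp [mark, hω]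
  · by_cases hω : ω ∈ A <;> simp [mark, hω, M.map_value]

lemma setLIntegral_inter_lt (M : IIDGeometricHorizon P X N μ Q) (hA : MeasurableSet[past X l] A)
    (hY : Measurable[past X l] Y) {g : ℝ → ℝ≥0∞} (hg : Measurable g) :
    ∫⁻ ω in A ∩ {ω | X l ω < Y ω}, g (Y ω) ∂P = ∫⁻ ω in A, g (Y ω) * μ (Iio (Y ω)) ∂P := by
  let f (z y : ℝ) : ℝ≥0∞ := (Iio z).indicator (fun _ => g z) y
  have hf : Measurable (uncurry f) :=
    (hg.comp measurable_fst).indicator (measurableSet_lt measurable_snd measurable_fst)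
  have hlt : MeasurableSet {ω | X l ω < Y ω} :=
    measurableSet_lt (M.measurable_value l) (hY.mono (past_le M.measurable_value l) le_rfl)
  calc ∫⁻ ω in A ∩ {ω | X l ω < Y ω}, g (Y ω) ∂P = ∫⁻ ω in A, f (Y ω) (X l ω) ∂P := by
        rw [inter_comm, ← setLIntegral_indicator hlt]
        rfl
    _ = ∫⁻ ω in A, g (Y ω) * μ (Iio (Y ω)) ∂P := by
        rw [M.setLIntegral_next hA hY hf]
        simp only [f, lintegral_indicator_const measurableSet_Iio]

lemma setLIntegral_forall_lt (M : IIDGeometricHorizon P X N μ Q) (hA : MeasurableSet[past X k] A)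
    (hY : Measurable[past X k] Y) (n : ℕ) {g : ℝ → ℝ≥0∞} (hg : Measurable g) :
    ∫⁻ ω in A ∩ {ω | ∀ l ∈ Finset.Ico k (k + n), X l ω < Y ω}, g (Y ω) ∂P =
      ∫⁻ ω in A, g (Y ω) * μ (Iio (Y ω)) ^ n ∂P := by
  induction n generalizing g with
  | zero => simp
  | succ n ih =>
    have hsplit : A ∩ {ω | ∀ l ∈ Finset.Ico k (k + (n + 1)), X l ω < Y ω} =
        (A ∩ {ω | ∀ l ∈ Finset.Ico k (k + n), X l ω < Y ω}) ∩ {ω | X (k + n) ω < Y ω} := by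
      ext ω
      rw [← add_assoc, ← Finset.insert_Ico_right_eq_Ico_add_one (Nat.le_add_right k n)]
      simp only [mem_inter_iff, mem_ofPred_eq, Finset.forall_mem_insert]
      tauto
    have hk : past X k ≤ past X (k + n) := past_mono (Nat.le_add_right k n)
    rw [hsplit, M.setLIntegral_inter_lt ((hk _ hA).inter (measurableSet_forall_lt hY n))
      (hY.mono hk le_rfl) hg]
    refine (ih (hg.mul (measurable_measure_Iio μ))).trans ?_
    simp only [Pi.mul_apply, mul_assoc, pow_succ']

lemma setLIntegral_duration (M : IIDGeometricHorizon P X N μ Q)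
    (hB : MeasurableSet[past X (k + 1)] B) (hY : Measurable[past X (k + 1)] Y) :
    ∫⁻ ω in {ω | k < N ω} ∩ B, duration X N k (Y ω) ω ∂P =
      Q ^ k * ∫⁻ ω in B, meanDuration μ Q (Y ω) ∂P := by
  let E (n : ℕ) : Set Ω := {ω | ∀ l ∈ Finset.Ico (k + 1) (k + 1 + n), X l ω < Y ω}
  have hE (n : ℕ) : MeasurableSet[past X (k + 1 + n)] (B ∩ E n) :=
    (past_mono (Nat.le_add_right _ n) _ hB).inter (measurableSet_forall_lt hY n)
  have hterm (n : ℕ) : P ({ω | k + n < N ω} ∩ (B ∩ E n)) =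
      Q ^ k * ∫⁻ ω in B, (Q * μ (Iio (Y ω))) ^ n ∂P := by
    have h := M.setLIntegral_forall_lt hB hY n (g := fun _ => Q ^ n) measurable_const
    rw [setLIntegral_const] at h
    simp only [M.measure_available_inter _ (hE n), pow_add, mul_assoc, mul_pow, ← h, E]
  have hYmeas : Measurable Y := hY.mono (past_le M.measurable_value _) le_rfl
  have hpow (n : ℕ) : AEMeasurable (fun ω => (Q * μ (Iio (Y ω))) ^ n) (P.restrict B) :=
    (((measurable_measure_Iio μ).comp hYmeas).const_mul Q |>.pow_const n).aemeasurable
  have hBmeas : MeasurableSet B := past_le M.measurable_value _ B hB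
  have hsE (n : ℕ) : MeasurableSet ({ω | k + n < N ω} ∩ E n) := (M.measurableSet_available _).inter
    (past_le M.measurable_value _ _ (measurableSet_forall_lt hY n))
  calc ∫⁻ ω in {ω | k < N ω} ∩ B, duration X N k (Y ω) ω ∂P
      = ∫⁻ ω in {ω | k < N ω} ∩ B, ∑' n, ({ω | k + n < N ω} ∩ E n).indicator 1 ω ∂P := by
        refine setLIntegral_congr_fun ((M.measurableSet_available k).inter hBmeas) fun ω hω => ?_
        rw [duration_eq_tsum hω.1]
        rfl
    _ = ∑' n, P ({ω | k + n < N ω} ∩ (B ∩ E n)) := by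
        rw [lintegral_tsum fun n => (measurable_one.indicator (hsE n)).aemeasurable]
        refine tsum_congr fun n => ?_
        rw [lintegral_indicator_one (hsE n), Measure.restrict_apply (hsE n)]
        congr 1
        ext ω
        simp only [mem_inter_iff, mem_ofPred_eq]
        have : k + n < N ω → k < N ω := by omega
        tauto
    _ = Q ^ k * ∫⁻ ω in B, meanDuration μ Q (Y ω) ∂P := by
        simp only [hterm, ENNReal.tsum_mul_left]
        rw [← lintegral_tsum hpow]
        simp only [ENNReal.tsum_geometric, meanDuration]

end IIDGeometricHorizon

end Independence

section Payoff

variable {Ω : Type*} {X : ℕ → Ω → ℝ} {N : Ω → ℕ} {K : ℕ → Ω → Prop} {τ : Ω → WithTop ℕ} {k : ℕ}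
  {b x : ℝ} {ω : Ω}

open Classical in
/-- The payoff of the rule `τ` when `K i` is the event that object `i` counts as a candidate. The
payoffs from the first stage and from a state `(k, x)` differ only in the choice of `K`. -/
noncomputable def gain (X : ℕ → Ω → ℝ) (N : Ω → ℕ) (K : ℕ → Ω → Prop) (τ : Ω → WithTop ℕ) (ω : Ω) :
    ℝ≥0∞ :=
  WithTop.recTopCoe 0 (fun i => if i < N ω ∧ K i ω then duration X N i (X i ω) ω else 0) (τ ω)

/-- Object `j > k` is a candidate, when the largest value up to stage `k` is `x`. -/
def IsCandidateAfter (X : ℕ → Ω → ℝ) (k : ℕ) (x : ℝ) (j : ℕ) (ω : Ω) : Prop :=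
  x ≤ X j ω ∧ ∀ l, k < l → l ≤ j → X l ω ≤ X j ω

lemma payoff_eq_gain : payoff X N τ = gain X N (IsCandidate X) τ := by
  unfold payoff gain
  congr!

lemma contPayoff_eq_gain : contPayoff X N k x τ = gain X N (IsCandidateAfter X k x) τ := by
  unfold contPayoff gain IsCandidateAfter
  congr!

lemma gain_of_eq_coe {i : ℕ} (hi : i < N ω) (hτ : τ ω = i) (hK : K i ω) :
    gain X N K τ ω = duration X N i (X i ω) ω := by
  unfold gain
  rw [hτ]
  exact if_pos ⟨hi, hK⟩

lemma exists_of_gain_ne_zero (h : gain X N K τ ω ≠ 0) : ∃ i : ℕ, i < N ω ∧ τ ω = i ∧ K i ω := by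
  unfold gain at h
  cases hτ : τ ω with
  | top => simp [hτ] at h
  | coe i =>
    by_contra! hcon
    refine h ?_
    rw [hτ]
    exact if_neg fun hi => hcon i hi.1 rfl hi.2

lemma measurableSet_isCandidate (X : ℕ → Ω → ℝ) (i : ℕ) :
    MeasurableSet[past X (i + 1)] {ω | IsCandidate X i ω} := by
  simp only [IsCandidate, ofPred_forall]
  exact MeasurableSet.iInter fun j => MeasurableSet.iInter fun hj => measurableSet_le
    (measurable_past (Nat.lt_succ_of_le hj)) (measurable_past i.lt_succ_self)

lemma measurableSet_isCandidateAfter (X : ℕ → Ω → ℝ) (k : ℕ) (x : ℝ) (i : ℕ) :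
    MeasurableSet[past X (i + 1)] {ω | IsCandidateAfter X k x i ω} := by
  have hi : Measurable[past X (i + 1)] (X i) := measurable_past i.lt_succ_self
  simp only [IsCandidateAfter, ofPred_and, ofPred_forall]
  exact (measurableSet_le measurable_const hi).inter <| MeasurableSet.iInter fun l =>
    MeasurableSet.iInter fun _ => MeasurableSet.iInter fun hl =>
      measurableSet_le (measurable_past (Nat.lt_succ_of_le hl)) hi

/-- The largest of `b` and the values `X k, …, X (k + n - 1)`. -/
def runMax (X : ℕ → Ω → ℝ) (k : ℕ) (b : ℝ) : ℕ → Ω → ℝ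
  | 0 => fun _ => b
  | n + 1 => fun ω => max (runMax X k b n ω) (X (k + n) ω)

lemma runMax_le_iff {n : ℕ} {c : ℝ} :
    runMax X k b n ω ≤ c ↔ b ≤ c ∧ ∀ l ∈ Finset.Ico k (k + n), X l ω ≤ c := by
  induction n with
  | zero => simp [runMax]
  | succ n ih =>
    rw [runMax, max_le_iff, ih, ← add_assoc,
      ← Finset.insert_Ico_right_eq_Ico_add_one (Nat.le_add_right k n), Finset.forall_mem_insert]
    tauto

lemma le_runMax (X : ℕ → Ω → ℝ) (k : ℕ) (b : ℝ) (n : ℕ) (ω : Ω) : b ≤ runMax X k b n ω :=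
  (runMax_le_iff.mp le_rfl).1

lemma measurable_runMax (X : ℕ → Ω → ℝ) (k : ℕ) (b : ℝ) (n : ℕ) :
    Measurable[past X (k + n)] (runMax X k b n) := by
  induction n with
  | zero => exact measurable_const
  | succ n ih =>
    exact (ih.mono (past_mono (Nat.le_succ _)) le_rfl).max (measurable_past (Nat.lt_succ_self _))

end Payoff

section Expectation

variable {Ω : Type*} [MeasurableSpace Ω] {P : Measure Ω} {X : ℕ → Ω → ℝ} {N : Ω → ℕ}
  {μ : Measure ℝ} {Q : ℝ≥0∞} {k l : ℕ} {B C : Set Ω} {Z : Ω → ℝ} {K : ℕ → Ω → Prop}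
  {τ : Ω → WithTop ℕ} {a b : ℝ}

namespace IIDGeometricHorizon

lemma lintegral_gain (M : IIDGeometricHorizon P X N μ Q) (hk : ∀ ω, (k : WithTop ℕ) ≤ τ ω)
    {B : ℕ → Set Ω} (hB : ∀ n, MeasurableSet[past X (k + n + 1)] (B n))
    (hτ : ∀ n ω, k + n < N ω → (ω ∈ B n ↔ τ ω = (k + n : ℕ) ∧ K (k + n) ω)) :
    ∫⁻ ω, gain X N K τ ω ∂P =
      Q ^ k * ∑' n, Q ^ n * ∫⁻ ω in B n, meanDuration μ Q (X (k + n) ω) ∂P := by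
  let S (n : ℕ) : Set Ω := {ω | k + n < N ω} ∩ B n
  have hS (n : ℕ) : MeasurableSet (S n) :=
    (M.measurableSet_available _).inter (past_le M.measurable_value _ _ (hB n))
  have hτS {n : ℕ} {ω : Ω} (hω : ω ∈ S n) : τ ω = (k + n : ℕ) ∧ K (k + n) ω :=
    (hτ n ω hω.1).mp hω.2
  have hdisj : Pairwise (Disjoint on S) := fun m n hmn => Set.disjoint_left.mpr fun ω hm hn =>
    hmn (Nat.add_left_cancel (WithTop.coe_injective ((hτS hm).1.symm.trans (hτS hn).1)))
  have hsupp : support (gain X N K τ) ⊆ ⋃ n, S n := fun ω hω => by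
    obtain ⟨i, hi, hτi, hKi⟩ := exists_of_gain_ne_zero hω
    obtain ⟨n, rfl⟩ := Nat.exists_eq_add_of_le (WithTop.coe_le_coe.mp ((hk ω).trans_eq hτi))
    exact mem_iUnion.mpr ⟨n, hi, (hτ n ω hi).mpr ⟨hτi, hKi⟩⟩
  have hterm (n : ℕ) : ∫⁻ ω in S n, gain X N K τ ω ∂P =
      Q ^ k * (Q ^ n * ∫⁻ ω in B n, meanDuration μ Q (X (k + n) ω) ∂P) := by
    rw [← mul_assoc, ← pow_add,
      ← M.setLIntegral_duration (hB n) (measurable_past (Nat.lt_succ_self _))]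
    exact setLIntegral_congr_fun (hS n) fun ω hω => gain_of_eq_coe hω.1 (hτS hω).1 (hτS hω).2
  rw [← setLIntegral_eq_of_support_subset hsupp, lintegral_iUnion hS hdisj]
  simp only [hterm, ENNReal.tsum_mul_left]

end IIDGeometricHorizon

namespace IsOptimalLevel

lemma setLIntegral_add_le (h : IsOptimalLevel μ Q a) (M : IIDGeometricHorizon P X N μ Q)
    (hC : MeasurableSet[past X l] C) (hB : MeasurableSet[past X (l + 1)] B) (hBC : B ⊆ C)
    (hZ : Measurable[past X l] Z) (haZ : ∀ ω, a ≤ Z ω) (hZB : ∀ ω ∈ B, Z ω ≤ max a (X l ω)) :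
    ∫⁻ ω in B, meanDuration μ Q (X l ω) ∂P +
        Q * ∫⁻ ω in C \ B, passageValue μ Q (max (Z ω) (X l ω)) ∂P ≤
      ∫⁻ ω in C, passageValue μ Q (Z ω) ∂P := by
  have hBmeas : MeasurableSet B := past_le M.measurable_value _ B hB
  have hselect : ∀ᵐ ω ∂P, ω ∈ B → meanDuration μ Q (X l ω) ≤ stepValue μ Q (Z ω) (X l ω) := by
    have hlaw := h.ae_meanDuration_le_stepValue
    rw [← M.map_value l] at hlaw
    filter_upwards [ae_of_ae_map (M.measurable_value l).aemeasurable hlaw] with ω hω hωB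
    rw [M.map_value l] at hω
    exact hω _ (haZ ω) (hZB ω hωB)
  calc _ ≤ ∫⁻ ω in B, stepValue μ Q (Z ω) (X l ω) ∂P +
        ∫⁻ ω in C \ B, stepValue μ Q (Z ω) (X l ω) ∂P := by
        rw [← lintegral_const_mul' _ _ (M.continuation_le_one.trans_lt ENNReal.one_lt_top).ne]
        exact add_le_add (setLIntegral_mono_ae' hBmeas hselect)
          (lintegral_mono fun ω => h.mul_passageValue_max_le_stepValue (haZ ω) _)
    _ = ∫⁻ ω in C, stepValue μ Q (Z ω) (X l ω) ∂P := by
        rw [add_comm, ← lintegral_inter_add_sdiff _ C hBmeas, inter_eq_right.mpr hBC, add_comm]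
    _ = ∫⁻ ω in C, passageValue μ Q (Z ω) ∂P := by
        simp only [M.setLIntegral_next hC hZ measurable_uncurry_stepValue, lintegral_stepValue]

lemma tsum_le_passageValue (h : IsOptimalLevel μ Q a) (M : IIDGeometricHorizon P X N μ Q)
    (hab : a ≤ b) {B : ℕ → Set Ω} (hB : ∀ n, MeasurableSet[past X (k + n + 1)] (B n))
    (hdisj : Pairwise (Disjoint on B))
    (hmax : ∀ n, ∀ ω ∈ B n, runMax X k b n ω ≤ max a (X (k + n) ω)) :
    ∑' n, Q ^ n * ∫⁻ ω in B n, meanDuration μ Q (X (k + n) ω) ∂P ≤ passageValue μ Q b := by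
  have := M.isProbabilityMeasure
  -- On `C n` no object has been selected before stage `k + n`.
  let C (n : ℕ) : Set Ω := (⋃ j ∈ Iio n, B j)ᶜ
  have hC (n : ℕ) : MeasurableSet[past X (k + n)] (C n) :=
    (MeasurableSet.biUnion (to_countable _) fun j hj =>
      past_mono (Nat.add_lt_add_left hj k) _ (hB j)).compl
  have hBC (n : ℕ) : B n ⊆ C n := fun ω hω hC => by
    obtain ⟨j, hj, hωj⟩ := mem_iUnion₂.mp hC
    exact Set.disjoint_left.mp (hdisj (ne_of_lt hj)) hωj hω
  have hCsucc (n : ℕ) : C (n + 1) = C n \ B n := by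
    ext ω
    simp only [C, mem_compl_iff, mem_iUnion, not_exists, mem_Iio, mem_sdiff,
      Nat.forall_lt_succ_right]
  have hstep (n : ℕ) := h.setLIntegral_add_le M (hC n) (hB n) (hBC n) (measurable_runMax X k b n)
    (fun ω => hab.trans (le_runMax X k b n ω)) (hmax n)
  have hsum (m : ℕ) : ∑ n ∈ Finset.range m, Q ^ n * ∫⁻ ω in B n, meanDuration μ Q (X (k + n) ω) ∂P +
      Q ^ m * ∫⁻ ω in C m, passageValue μ Q (runMax X k b m ω) ∂P ≤ passageValue μ Q b := by
    induction m with
    | zero => simp [C, runMax]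
    | succ m ih =>
      refine le_trans ?_ ih
      rw [Finset.sum_range_succ, add_assoc, pow_succ, mul_assoc, ← mul_add, hCsucc]
      gcongr
      exact hstep m
  rw [ENNReal.tsum_eq_iSup_nat]
  exact iSup_le fun m => le_self_add.trans (hsum m)

lemma lintegral_gain_le (h : IsOptimalLevel μ Q a) (M : IIDGeometricHorizon P X N μ Q)
    {hX : ∀ i, Measurable (X i)} {hN : Measurable N} (hτ : IsStoppingTime (info X N hX hN) τ)
    (hk : ∀ ω, (k : WithTop ℕ) ≤ τ ω) (hK : ∀ i, MeasurableSet[past X (i + 1)] {ω | K i ω})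
    (hab : a ≤ b) (hmax : ∀ n ω, K (k + n) ω → runMax X k b n ω ≤ max a (X (k + n) ω)) :
    ∫⁻ ω, gain X N K τ ω ∂P ≤ Q ^ k * passageValue μ Q b := by
  obtain ⟨B, hB, hdisj, hBτ⟩ := exists_disjoint_past_of_isStoppingTime hτ
  have hBK (n : ℕ) : MeasurableSet[past X (k + n + 1)] (B (k + n) ∩ {ω | K (k + n) ω}) :=
    (hB _).inter (hK _)
  rw [M.lintegral_gain hk hBK fun n ω hn => and_congr_left' (hBτ _ ω hn)]
  gcongr
  refine h.tsum_le_passageValue M hab hBK (fun m n hmn => ?_) fun n ω hω => hmax n ω hω.2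
  exact (hdisj (mt Nat.add_left_cancel hmn)).mono inter_subset_left inter_subset_left

end IsOptimalLevel

end Expectation

section FirstPassage

variable {Ω : Type*} {X : ℕ → Ω → ℝ} {N : Ω → ℕ} {τ : Ω → WithTop ℕ} {k : ℕ} {a : ℝ}

/-- `τ` selects the first available object `i ≥ k` of value at least `a`, and never stops if there
is none. -/
def IsFirstPassage (X : ℕ → Ω → ℝ) (N : Ω → ℕ) (k : ℕ) (a : ℝ) (τ : Ω → WithTop ℕ) : Prop :=
  ∀ ω (i : ℕ), τ ω = i ↔ k ≤ i ∧ i < N ω ∧ a ≤ X i ω ∧ ∀ l ∈ Finset.Ico k i, X l ω < a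

lemma dite_find_eq_coe_iff {p : ℕ → Prop} [DecidablePred p] [Decidable (∃ i, p i)] {i : ℕ} :
    (if h : ∃ i, p i then ((Nat.find h : ℕ) : WithTop ℕ) else ⊤) = i ↔
      p i ∧ ∀ j < i, ¬ p j := by
  split_ifs with h
  · rw [Nat.cast_inj, Nat.find_eq_iff]
  · exact iff_of_false WithTop.top_ne_coe fun hi => h ⟨i, hi.1⟩

lemma exists_isFirstPassage (X : ℕ → Ω → ℝ) (N : Ω → ℕ) (k : ℕ) (a : ℝ) :
    ∃ τ, IsFirstPassage X N k a τ := by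
  classical
  refine ⟨fun ω => if h : ∃ i, k ≤ i ∧ i < N ω ∧ a ≤ X i ω then ((Nat.find h : ℕ) : WithTop ℕ)
    else ⊤, fun ω i => ?_⟩
  rw [dite_find_eq_coe_iff]
  simp only [Finset.mem_Ico]
  grind

lemma isFirstPassage_threshold (X : ℕ → Ω → ℝ) (N : Ω → ℕ) (a : ℝ) :
    IsFirstPassage X N 0 a (threshold X N a) := fun ω i => by
  classical
  rw [threshold, dite_find_eq_coe_iff]
  constructor
  · rintro ⟨⟨hi, -, hai⟩, hfirst⟩
    refine ⟨i.zero_le, hi, hai, fun l hl => not_le.mp fun hal => ?_⟩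
    -- The first object of value at least `a` is automatically a candidate.
    have hex : ∃ m, a ≤ X m ω := ⟨l, hal⟩
    have hfind : Nat.find hex < i := (Nat.find_le hal).trans_lt (Finset.mem_Ico.mp hl).2
    refine hfirst _ hfind ⟨hfind.trans hi, fun j hj => ?_, Nat.find_spec hex⟩
    rcases hj.lt_or_eq with hj | rfl
    · exact (not_le.mp (Nat.find_min hex hj)).le.trans (Nat.find_spec hex)
    · exact le_rfl
  · rintro ⟨-, hi, hai, hlt⟩
    refine ⟨⟨hi, fun j hj => ?_, hai⟩, fun j hj h => ?_⟩
    · rcases hj.lt_or_eq with hj | rfl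
      · exact (hlt j (by simpa using hj)).le.trans hai
      · exact le_rfl
    · exact (hlt j (by simpa using hj)).not_ge h.2.2

namespace IsFirstPassage

lemma le (h : IsFirstPassage X N k a τ) (ω : Ω) : (k : WithTop ℕ) ≤ τ ω := by
  cases hτ : τ ω with
  | top => exact le_top
  | coe i => exact WithTop.coe_le_coe.mpr ((h ω i).mp hτ).1

lemma isStoppingTime [MeasurableSpace Ω] (h : IsFirstPassage X N k a τ)
    (hX : ∀ i, Measurable (X i)) (hN : Measurable N) : IsStoppingTime (info X N hX hN) τ := by
  refine isStoppingTime_of_measurableSet_eq fun i => ?_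
  have hvalue {l : ℕ} (hl : l ≤ i) : Measurable[info X N hX hN i] (X l) :=
    (measurable_info hX hN hl).fst
  have havailable : MeasurableSet[info X N hX hN i] {ω | i < N ω} := by
    convert (measurable_info hX hN le_rfl).snd (measurableSet_singleton (1 : ℝ)) using 1
    ext ω
    simp
  change MeasurableSet[info X N hX hN i] {ω | τ ω = (i : WithTop ℕ)}
  simp only [h _ i, ofPred_and, ofPred_forall]
  refine (MeasurableSet.const _).inter (havailable.inter
    ((measurableSet_le measurable_const (hvalue le_rfl)).inter ?_))
  exact Finset.measurableSet_biInter _ fun l hl =>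
    measurableSet_lt (hvalue (Finset.mem_Ico.mp hl).2.le) measurable_const

end IsFirstPassage

end FirstPassage

section FirstPassageValue

variable {Ω : Type*} [MeasurableSpace Ω] {P : Measure Ω} {X : ℕ → Ω → ℝ} {N : Ω → ℕ}
  {μ : Measure ℝ} {Q : ℝ≥0∞} {k : ℕ} {K : ℕ → Ω → Prop} {τ : Ω → WithTop ℕ} {a : ℝ}

namespace IIDGeometricHorizon

lemma setLIntegral_firstPassage (M : IIDGeometricHorizon P X N μ Q) (k n : ℕ) (a : ℝ) :
    ∫⁻ ω in {ω | ∀ l ∈ Finset.Ico k (k + n), X l ω < a} ∩ {ω | a ≤ X (k + n) ω},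
      meanDuration μ Q (X (k + n) ω) ∂P = μ (Iio a) ^ n * tailDuration μ Q a := by
  have := M.isProbabilityMeasure
  have hbelow : MeasurableSet[past X (k + n)] {ω | ∀ l ∈ Finset.Ico k (k + n), X l ω < a} :=
    measurableSet_forall_lt measurable_const n
  have hmeasure : P {ω | ∀ l ∈ Finset.Ico k (k + n), X l ω < a} = μ (Iio a) ^ n := by
    have h := M.setLIntegral_forall_lt (k := k) (Y := fun _ => a) MeasurableSet.univ
      measurable_const n (g := fun _ => 1) measurable_const
    simpa only [univ_inter, setLIntegral_const, one_mul, measure_univ, mul_one] using h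
  let f (_ y : ℝ) : ℝ≥0∞ := (Ici a).indicator (meanDuration μ Q) y
  have hf : Measurable (uncurry f) :=
    (measurable_meanDuration.indicator measurableSet_Ici).comp measurable_snd
  calc _ = ∫⁻ ω in {ω | ∀ l ∈ Finset.Ico k (k + n), X l ω < a}, f a (X (k + n) ω) ∂P := by
        rw [inter_comm, ← setLIntegral_indicator (s := {ω | a ≤ X (k + n) ω})
          (measurableSet_le measurable_const (M.measurable_value _))]
        rfl
    _ = μ (Iio a) ^ n * tailDuration μ Q a := by
        rw [M.setLIntegral_next hbelow (Z := fun _ => a) measurable_const hf]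
        simp only [f]
        rw [lintegral_indicator measurableSet_Ici, setLIntegral_const, hmeasure, mul_comm,
          tailDuration]

lemma lintegral_gain_of_isFirstPassage (M : IIDGeometricHorizon P X N μ Q)
    (hτ : IsFirstPassage X N k a τ)
    (hK : ∀ i ω, (∀ l ∈ Finset.Ico k i, X l ω < a) → a ≤ X i ω → K i ω) :
    ∫⁻ ω, gain X N K τ ω ∂P = Q ^ k * passageValue μ Q a := by
  have hmeas (n : ℕ) : MeasurableSet[past X (k + n + 1)]
      ({ω | ∀ l ∈ Finset.Ico k (k + n), X l ω < a} ∩ {ω | a ≤ X (k + n) ω}) :=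
    (past_mono (Nat.le_succ _) _ (measurableSet_forall_lt measurable_const n)).inter
      (measurableSet_le measurable_const (measurable_past (Nat.lt_succ_self _)))
  rw [M.lintegral_gain hτ.le hmeas fun n ω hn => ?_]
  · simp only [M.setLIntegral_firstPassage, ← mul_assoc, ← mul_pow]
    rw [ENNReal.tsum_mul_right, ENNReal.tsum_geometric, passageValue, meanDuration]
  · rw [hτ ω]
    exact ⟨fun h => ⟨⟨Nat.le_add_right k n, hn, h.2, h.1⟩, hK _ ω h.1 h.2⟩,
      fun h => ⟨h.1.2.2.2, h.1.2.2.1⟩⟩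

lemma lintegral_payoff_threshold (M : IIDGeometricHorizon P X N μ Q) (a : ℝ) :
    ∫⁻ ω, payoff X N (threshold X N a) ω ∂P = passageValue μ Q a := by
  simp only [payoff_eq_gain]
  rw [M.lintegral_gain_of_isFirstPassage (isFirstPassage_threshold X N a) ?_, pow_zero, one_mul]
  intro i ω hlt hi j hj
  rcases hj.lt_or_eq with hj | rfl
  · exact (hlt j (by simpa using hj)).le.trans hi
  · exact le_rfl

lemma lintegral_payoff_zero (M : IIDGeometricHorizon P X N μ Q) :
    ∫⁻ ω, payoff X N (fun _ => 0) ω ∂P = ∫⁻ y, meanDuration μ Q y ∂μ := by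
  let B (n : ℕ) : Set Ω := {_ω | n = 0}
  have hB (n : ℕ) : MeasurableSet[past X (0 + n + 1)] (B n) := MeasurableSet.const _
  simp only [payoff_eq_gain]
  rw [M.lintegral_gain (k := 0) (τ := fun _ => 0) (fun _ => le_rfl) hB fun n ω _ => ?_,
    tsum_eq_single 0 fun n hn => by simp [B, hn]]
  · simp only [B, ofPred_true, pow_zero, one_mul, Measure.restrict_univ, add_zero]
    rw [← M.map_value 0, lintegral_map measurable_meanDuration (M.measurable_value 0)]
  · rcases eq_or_ne n 0 with rfl | hn
    · simp [B, IsCandidate]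
    · simp [B, hn, eq_comm (a := (0 : WithTop ℕ))]

end IIDGeometricHorizon

end FirstPassageValue

section Optimality

variable {Ω : Type*} [MeasurableSpace Ω] {P : Measure Ω} {X : ℕ → Ω → ℝ} {N : Ω → ℕ}
  {hX : ∀ i, Measurable (X i)} {hN : Measurable N} {μ : Measure ℝ} {Q : ℝ≥0∞} {k : ℕ}
  {τ : Ω → WithTop ℕ} {a x : ℝ}

namespace IIDGeometricHorizon

lemma lintegral_cond_available (M : IIDGeometricHorizon P X N μ Q) (k : ℕ) (f : Ω → ℝ≥0∞) :
    ∫⁻ ω, f ω ∂P[|{ω | k < N ω}] = (Q ^ k)⁻¹ * ∫⁻ ω in {ω | k < N ω}, f ω ∂P := by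
  rw [ProbabilityTheory.cond, lintegral_smul_measure, M.measure_lt_horizon, smul_eq_mul]

lemma inv_pow_mul_pow_mul (M : IIDGeometricHorizon P X N μ Q) (hQ : Q ≠ 0) (k : ℕ) (c : ℝ≥0∞) :
    (Q ^ k)⁻¹ * (Q ^ k * c) = c := by
  rw [← mul_assoc, ENNReal.inv_mul_cancel (pow_ne_zero k hQ)
    (ENNReal.pow_ne_top (M.continuation_le_one.trans_lt ENNReal.one_lt_top).ne), one_mul]

lemma stopValue_eq (M : IIDGeometricHorizon P X N μ Q) (hQ : Q ≠ 0) (k : ℕ) (x : ℝ) :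
    stopValue P X N k x = meanDuration μ Q x := by
  have := M.isProbabilityMeasure
  have h := M.setLIntegral_duration (k := k) (Y := fun _ => x) MeasurableSet.univ measurable_const
  simp only [inter_univ, Measure.restrict_univ, lintegral_const, measure_univ, mul_one] at h
  rw [stopValue, M.lintegral_cond_available, h, M.inv_pow_mul_pow_mul hQ]

lemma lintegral_contPayoff_cond (M : IIDGeometricHorizon P X N μ Q)
    (hτ : ∀ ω, ((k + 1 : ℕ) : WithTop ℕ) ≤ τ ω) :
    ∫⁻ ω, contPayoff X N k x τ ω ∂P[|{ω | k < N ω}] =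
      (Q ^ k)⁻¹ * ∫⁻ ω, gain X N (IsCandidateAfter X k x) τ ω ∂P := by
  rw [M.lintegral_cond_available, contPayoff_eq_gain, setLIntegral_eq_of_support_subset]
  intro ω hω
  obtain ⟨i, hi, hτi, -⟩ := exists_of_gain_ne_zero hω
  exact (Nat.lt_of_succ_le (WithTop.coe_le_coe.mp ((hτ ω).trans_eq hτi))).trans hi

end IIDGeometricHorizon

namespace IsOptimalLevel

lemma value_eq (h : IsOptimalLevel μ Q a) (M : IIDGeometricHorizon P X N μ Q) :
    value P X N hX hN = passageValue μ Q a := by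
  refine le_antisymm (iSup₂_le fun τ hτ => ?_) ?_
  · rw [payoff_eq_gain]
    refine (h.lintegral_gain_le M (k := 0) hτ (fun _ => zero_le) (measurableSet_isCandidate X)
      le_rfl fun n ω hω => ?_).trans_eq (by rw [pow_zero, one_mul])
    exact runMax_le_iff.mpr ⟨le_max_left _ _, fun l hl =>
      (hω l (Finset.mem_Ico.mp hl).2.le).trans (le_max_right _ _)⟩
  · rw [← M.lintegral_payoff_threshold a]
    exact le_iSup₂_of_le _ ((isFirstPassage_threshold X N a).isStoppingTime hX hN) le_rfl

lemma isOptimal_threshold (h : IsOptimalLevel μ Q a) (M : IIDGeometricHorizon P X N μ Q) :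
    IsOptimal P X N hX hN (threshold X N a) :=
  ⟨(isFirstPassage_threshold X N a).isStoppingTime hX hN,
    (M.lintegral_payoff_threshold a).trans (h.value_eq M).symm⟩

lemma isOptimal_zero (h : IsOptimalLevel μ Q a) (M : IIDGeometricHorizon P X N μ Q)
    (ha : μ (Iio a) = 0) : IsOptimal P X N hX hN fun _ => 0 := by
  refine ⟨isStoppingTime_const _ 0, ?_⟩
  rw [M.lintegral_payoff_zero, h.value_eq M, passageValue_of_measure_Iio_eq_zero ha]

lemma contValue_eq (h : IsOptimalLevel μ Q a) (M : IIDGeometricHorizon P X N μ Q) (hQ : Q ≠ 0)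
    (k : ℕ) (x : ℝ) : contValue P X N hX hN k x = Q * passageValue μ Q (max a x) := by
  have hdiscount (c : ℝ≥0∞) : (Q ^ k)⁻¹ * (Q ^ (k + 1) * c) = Q * c := by
    rw [pow_succ, mul_assoc, M.inv_pow_mul_pow_mul hQ]
  rw [← hdiscount]
  refine le_antisymm (iSup₂_le fun τ hτ => ?_) ?_
  · have hk (ω : Ω) : ((k + 1 : ℕ) : WithTop ℕ) ≤ τ ω :=
      WithTop.succ_coe.ge.trans (Order.succ_le_of_lt (hτ.2 ω))
    rw [M.lintegral_contPayoff_cond hk]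
    gcongr
    refine h.lintegral_gain_le M hτ.1 hk (measurableSet_isCandidateAfter X k x)
      (le_max_left a x) fun n ω hω => runMax_le_iff.mpr ⟨max_le_max_left a hω.1, fun l hl => ?_⟩
    have hl := Finset.mem_Ico.mp hl
    exact (hω.2 l hl.1 hl.2.le).trans (le_max_right _ _)
  · obtain ⟨τ, hτ⟩ := exists_isFirstPassage X N (k + 1) (max a x)
    have hk (ω : Ω) : (k : WithTop ℕ) < τ ω :=
      (WithTop.coe_lt_coe.mpr k.lt_succ_self).trans_le (hτ.le ω)
    rw [← M.lintegral_gain_of_isFirstPassage hτ (K := IsCandidateAfter X k x) fun i ω hlt hi =>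
      ⟨(le_max_right a x).trans hi, fun l hkl hli => ?_⟩, ← M.lintegral_contPayoff_cond hτ.le]
    · exact le_iSup₂_of_le τ ⟨hτ.isStoppingTime hX hN, hk⟩ le_rfl
    · rcases hli.lt_or_eq with hli | rfl
      · exact (hlt l (Finset.mem_Ico.mpr ⟨hkl, hli⟩)).le.trans hi
      · exact le_rfl

lemma contValue_le_stopValue (h : IsOptimalLevel μ Q a) (M : IIDGeometricHorizon P X N μ Q)
    (hQ : Q ≠ 0) (k : ℕ) (hx : a ≤ x) : contValue P X N hX hN k x ≤ stopValue P X N k x := by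
  rw [h.contValue_eq M hQ, M.stopValue_eq hQ, max_eq_right hx]
  exact h.mul_passageValue_le hx

lemma stoppingRegion_eq_states (h : IsOptimalLevel μ Q a) (M : IIDGeometricHorizon P X N μ Q)
    (hQ : Q ≠ 0) (ha : a ≤ 0) : stoppingRegion P X N hX hN = states :=
  sep_eq_self_iff_mem_true.mpr fun s hs => h.contValue_le_stopValue M hQ s.1 (ha.trans hs.1)

end IsOptimalLevel

lemma IIDGeometricHorizon.stoppingRegion_eq (M : IIDGeometricHorizon P X N μ Q) (hQ : Q ≠ 0)
    (ha : Q * tailDuration μ Q a = 1)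
    (hlt : ∀ x ∈ Icc (0 : ℝ) 1, x < a → meanDuration μ Q x < meanDuration μ Q a) :
    stoppingRegion P X N hX hN = {s ∈ states | a ≤ s.2} := by
  have h := IsOptimalLevel.of_mul_tailDuration_eq_one ha
  refine Set.ext fun s => and_congr_right fun hs =>
    ⟨fun hle => ?_, h.contValue_le_stopValue M hQ s.1⟩
  by_contra! hsa
  rw [h.contValue_eq M hQ, M.stopValue_eq hQ, max_eq_left hsa.le,
    mul_passageValue_of_mul_tailDuration_eq_one ha] at hle
  exact (hlt s.2 hs hsa).not_ge hle

end Optimality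

section Uniform

variable {q a x : ℝ}

/-- The uniform law on `[0, 1]`. -/
noncomputable abbrev unitUniform : Measure ℝ := volume.restrict (Icc 0 1)

lemma map_eq_unitUniform {Ω : Type*} [MeasurableSpace Ω] {P : Measure Ω} {Y : Ω → ℝ}
    (h : pdf.IsUniform Y (Icc (0 : ℝ) 1) P volume) : P.map Y = unitUniform := by
  rw [pdf.IsUniform] at h
  rw [h, ProbabilityTheory.cond, Real.volume_Icc, sub_zero, ENNReal.ofReal_one, inv_one, one_smul]

lemma unitUniform_Iio (hx : x ≤ 1) : unitUniform (Iio x) = ENNReal.ofReal x := by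
  have hinter : Iio x ∩ Icc 0 1 = Ico 0 x := by
    ext y
    simp only [mem_inter_iff, mem_Iio, mem_Icc, mem_Ico]
    grind
  rw [Measure.restrict_apply measurableSet_Iio, hinter, Real.volume_Ico, sub_zero]

lemma one_sub_mul_pos (hq0 : 0 < q) (hq1 : q < 1) (hx : x ≤ 1) : 0 < 1 - q * x := by nlinarith

lemma meanDuration_unitUniform (hq0 : 0 < q) (hq1 : q < 1) (hx : x ∈ Icc (0 : ℝ) 1) :
    meanDuration unitUniform (ENNReal.ofReal q) x = ENNReal.ofReal (1 / (1 - q * x)) := by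
  rw [meanDuration, unitUniform_Iio hx.2, ← ENNReal.ofReal_mul hq0.le, ← ENNReal.ofReal_one,
    ← ENNReal.ofReal_sub _ (mul_nonneg hq0.le hx.1),
    ← ENNReal.ofReal_inv_of_pos (one_sub_mul_pos hq0 hq1 hx.2), one_div]

lemma meanDuration_unitUniform_strictMonoOn (hq0 : 0 < q) (hq1 : q < 1) :
    StrictMonoOn (meanDuration unitUniform (ENNReal.ofReal q)) (Icc 0 1) := fun x hx y hy hxy => by
  have hy0 := one_sub_mul_pos hq0 hq1 hy.2
  rw [meanDuration_unitUniform hq0 hq1 hx, meanDuration_unitUniform hq0 hq1 hy,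
    ENNReal.ofReal_lt_ofReal_iff (one_div_pos.mpr hy0)]
  gcongr

lemma integral_one_div_one_sub_mul (hq0 : 0 < q) (hq1 : q < 1) (ha : a ≤ 1) :
    ∫ x in a..1, 1 / (1 - q * x) = 1 / q * Real.log ((1 - q * a) / (1 - q)) := by
  have hpos {x : ℝ} (hx : x ∈ uIcc a 1) : 0 < 1 - q * x :=
    one_sub_mul_pos hq0 hq1 (uIcc_of_le ha ▸ hx).2
  have hderiv (x : ℝ) (hx : x ∈ uIcc a 1) :
      HasDerivAt (fun x => -(1 / q) * Real.log (1 - q * x)) (1 / (1 - q * x)) x := by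
    have hlin : HasDerivAt (fun x => 1 - q * x) (-q) x := by
      simpa using ((hasDerivAt_id x).const_mul q).const_sub 1
    refine ((hlin.log (hpos hx).ne').const_mul (-(1 / q))).congr_deriv ?_
    field_simp
  have hcont : ContinuousOn (fun x => 1 / (1 - q * x)) (uIcc a 1) :=
    ContinuousOn.div (by fun_prop) (by fun_prop) fun x hx => (hpos hx).ne'
  rw [intervalIntegral.integral_eq_sub_of_hasDerivAt hderiv hcont.intervalIntegrable,
    Real.log_div (hpos left_mem_uIcc).ne' (sub_pos.mpr hq1).ne', mul_one]
  ring

lemma tailDuration_unitUniform (hq0 : 0 < q) (hq1 : q < 1) (ha : a ∈ Icc (0 : ℝ) 1) :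
    tailDuration unitUniform (ENNReal.ofReal q) a =
      ENNReal.ofReal (1 / q * Real.log ((1 - q * a) / (1 - q))) := by
  have hinter : Ici a ∩ Icc 0 1 = Icc a 1 := by
    ext y
    simp only [mem_inter_iff, mem_Ici, mem_Icc]
    grind
  have hpos {x : ℝ} (hx : x ∈ Icc a 1) : 0 < 1 - q * x := one_sub_mul_pos hq0 hq1 hx.2
  have hcont : ContinuousOn (fun x => 1 / (1 - q * x)) (Icc a 1) :=
    ContinuousOn.div (by fun_prop) (by fun_prop) fun x hx => (hpos hx).ne'
  rw [← integral_one_div_one_sub_mul hq0 hq1 ha.2, intervalIntegral.integral_of_le ha.2,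
    ← integral_Icc_eq_integral_Ioc, ofReal_integral_eq_lintegral_ofReal hcont.integrableOn_Icc
      ((ae_restrict_mem measurableSet_Icc).mono fun x hx => (one_div_pos.mpr (hpos hx)).le),
    tailDuration, Measure.restrict_restrict measurableSet_Ici, hinter]
  exact setLIntegral_congr_fun measurableSet_Icc fun x hx =>
    meanDuration_unitUniform hq0 hq1 ⟨ha.1.trans hx.1, hx.2⟩

lemma ofReal_mul_tailDuration_unitUniform (hq0 : 0 < q) (hq1 : q < 1) (ha : a ∈ Icc (0 : ℝ) 1) :
    ENNReal.ofReal q * tailDuration unitUniform (ENNReal.ofReal q) a =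
      ENNReal.ofReal (Real.log ((1 - q * a) / (1 - q))) := by
  rw [tailDuration_unitUniform hq0 hq1 ha, ← ENNReal.ofReal_mul hq0.le, ← mul_assoc,
    mul_one_div_cancel hq0.ne', one_mul]

lemma passageValue_unitUniform (hq0 : 0 < q) (hq1 : q < 1) (ha : a ∈ Icc (0 : ℝ) 1) :
    passageValue unitUniform (ENNReal.ofReal q) a =
      ENNReal.ofReal (1 / (1 - q * a) * (1 / q * Real.log ((1 - q * a) / (1 - q)))) := by
  rw [passageValue, meanDuration_unitUniform hq0 hq1 ha, tailDuration_unitUniform hq0 hq1 ha,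
    ← ENNReal.ofReal_mul (one_div_pos.mpr (one_sub_mul_pos hq0 hq1 ha.2)).le]

lemma level_lt_one (hq0 : 0 < q) (hq1 : q < 1) (hlevel : 1 - q * a = Real.exp 1 * (1 - q)) :
    a < 1 := by
  have he : 1 < Real.exp 1 := Real.one_lt_exp_iff.mpr one_pos
  nlinarith

lemma level_nonneg (hq0 : 0 < q) (hlevel : 1 - q * a = Real.exp 1 * (1 - q))
    (hq : 1 - q ≤ Real.exp (-1)) : 0 ≤ a := by
  have hle := mul_le_mul_of_nonneg_left hq (Real.exp_pos 1).le
  rw [← Real.exp_add, add_neg_cancel, Real.exp_zero, ← hlevel] at hle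
  exact nonneg_of_mul_nonneg_right (by linarith) hq0

lemma level_pos (hq0 : 0 < q) (hlevel : 1 - q * a = Real.exp 1 * (1 - q))
    (hq : 1 - q < Real.exp (-1)) : 0 < a := by
  have hlt := mul_lt_mul_of_pos_left hq (Real.exp_pos 1)
  rw [← Real.exp_add, add_neg_cancel, Real.exp_zero, ← hlevel] at hlt
  exact pos_of_mul_pos_right (by linarith) hq0.le

lemma log_level (hq1 : q < 1) (hlevel : 1 - q * a = Real.exp 1 * (1 - q)) :
    Real.log ((1 - q * a) / (1 - q)) = 1 := by
  rw [hlevel, mul_div_cancel_right₀ _ (sub_pos.mpr hq1).ne', Real.log_exp]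

lemma ofReal_mul_tailDuration_eq_one (hq0 : 0 < q) (hq1 : q < 1) (ha : a ∈ Icc (0 : ℝ) 1)
    (hlevel : 1 - q * a = Real.exp 1 * (1 - q)) :
    ENNReal.ofReal q * tailDuration unitUniform (ENNReal.ofReal q) a = 1 := by
  rw [ofReal_mul_tailDuration_unitUniform hq0 hq1 ha, log_level hq1 hlevel, ENNReal.ofReal_one]

lemma passageValue_unitUniform_of_level (hq0 : 0 < q) (hq1 : q < 1) (ha : a ∈ Icc (0 : ℝ) 1)
    (hlevel : 1 - q * a = Real.exp 1 * (1 - q)) :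
    passageValue unitUniform (ENNReal.ofReal q) a =
      ENNReal.ofReal (a / (1 - q * a) - 1 / q * Real.log ((1 - q) / (1 - q * a))) := by
  have hpos := one_sub_mul_pos hq0 hq1 ha.2
  rw [passageValue_unitUniform hq0 hq1 ha, ← inv_div (1 - q * a) (1 - q), Real.log_inv,
    log_level hq1 hlevel]
  congr 1
  field_simp
  ring

lemma isOptimalLevel_zero_unitUniform (hq0 : 0 < q) (hq1 : q < 1) (hq : Real.exp (-1) < 1 - q) :
    IsOptimalLevel unitUniform (ENNReal.ofReal q) 0 := by
  refine .of_measure_Iio_eq_zero ?_ (by rw [unitUniform_Iio zero_le_one, ENNReal.ofReal_zero])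
  rw [ofReal_mul_tailDuration_unitUniform hq0 hq1 ⟨le_rfl, zero_le_one⟩, ENNReal.ofReal_le_one,
    mul_zero, sub_zero, one_div, Real.log_inv]
  linarith [(Real.lt_log_iff_exp_lt (sub_pos.mpr hq1)).mpr hq]

lemma passageValue_unitUniform_zero (hq0 : 0 < q) (hq1 : q < 1) :
    passageValue unitUniform (ENNReal.ofReal q) 0 =
      ENNReal.ofReal (-(1 / q) * Real.log (1 - q)) := by
  rw [passageValue_unitUniform hq0 hq1 ⟨le_rfl, zero_le_one⟩, mul_zero, sub_zero, one_div_one,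
    one_mul, one_div (1 - q), Real.log_inv, mul_neg, neg_mul]

end Uniform

section Geometric

variable {Ω : Type*} [MeasurableSpace Ω] {P : Measure Ω} {N : Ω → ℕ} {q : ℝ}

lemma measure_lt_of_geometric (hq0 : 0 < q) (hq1 : q < 1) (hN : Measurable N)
    (hgeom : ∀ k : ℕ, P {ω | N ω = k + 1} = ENNReal.ofReal ((1 - q) * q ^ k)) (n : ℕ) :
    P {ω | n < N ω} = ENNReal.ofReal q ^ n := by
  have hunion : {ω | n < N ω} = ⋃ i : ℕ, {ω | N ω = (n + i) + 1} := by
    ext ω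
    simp only [mem_ofPred_eq, mem_iUnion]
    exact ⟨fun h => ⟨N ω - n - 1, by omega⟩, by rintro ⟨i, hi⟩; omega⟩
  have hdisj : Pairwise (Disjoint on fun i => {ω | N ω = (n + i) + 1}) := fun i j hij =>
    Set.disjoint_left.mpr fun ω hi hj => hij (by simp only [mem_ofPred_eq] at hi hj; omega)
  have hterm (i : ℕ) : P {ω | N ω = (n + i) + 1} =
      ENNReal.ofReal q ^ n * ENNReal.ofReal (1 - q) * ENNReal.ofReal q ^ i := by
    rw [hgeom, ENNReal.ofReal_mul (sub_pos.mpr hq1).le, ENNReal.ofReal_pow hq0.le, pow_add]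
    ring
  have hcompl : 1 - ENNReal.ofReal q = ENNReal.ofReal (1 - q) := by
    rw [ENNReal.ofReal_sub _ hq0.le, ENNReal.ofReal_one]
  rw [hunion, measure_iUnion hdisj fun i => hN (measurableSet_singleton _)]
  simp only [hterm]
  rw [ENNReal.tsum_mul_left, ENNReal.tsum_geometric, hcompl, mul_assoc,
    ENNReal.mul_inv_cancel (by simpa using hq1) ENNReal.ofReal_ne_top, mul_one]

end Geometric

end GeomDuration

theorem mainTheorem4 {Ω : Type*} [MeasurableSpace Ω] (P : Measure Ω) [IsProbabilityMeasure P]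
    (X : ℕ → Ω → ℝ) (N : Ω → ℕ) (p q : ℝ) (hp0 : 0 < p) (hp1 : p < 1) (hq : q = 1 - p)
    (hX : ∀ i, Measurable (X i)) (hN : Measurable N)
    (hunif : ∀ i, pdf.IsUniform (X i) (Set.Icc (0 : ℝ) 1) P volume)
    (hindep : iIndepFun X P)
    (hgeom : ∀ k : ℕ, P {ω | N ω = k + 1} = ENNReal.ofReal (p * q ^ k))
    (hNX : IndepFun N (fun ω i => X i ω) P) :
    (p ≤ Real.exp (-1) →
      ∀ x₀ : ℝ, x₀ = (1 - Real.exp 1 * p) / q →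
        0 ≤ x₀ ∧ x₀ < 1 ∧ (p < Real.exp (-1) → 0 < x₀) ∧
        GeomDuration.stoppingRegion P X N hX hN = {s ∈ GeomDuration.states | x₀ ≤ s.2} ∧
        GeomDuration.IsOptimal P X N hX hN (GeomDuration.threshold X N x₀) ∧
        GeomDuration.value P X N hX hN =
          ENNReal.ofReal (x₀ / (1 - q * x₀) - 1 / q * Real.log ((1 - q) / (1 - q * x₀)))) ∧
    (Real.exp (-1) < p →
      GeomDuration.stoppingRegion P X N hX hN = GeomDuration.states ∧
      GeomDuration.IsOptimal P X N hX hN (fun _ => 0) ∧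
      GeomDuration.value P X N hX hN = ENNReal.ofReal (-(1 / q) * Real.log (1 - q))) := by
  obtain rfl : p = 1 - q := by linarith
  have hq0 : 0 < q := by linarith
  have hq1 : q < 1 := sub_pos.mp hp0
  have hQ : ENNReal.ofReal q ≠ 0 := (ENNReal.ofReal_pos.mpr hq0).ne'
  have M : GeomDuration.IIDGeometricHorizon P X N GeomDuration.unitUniform (ENNReal.ofReal q) :=
    ⟨hX, hN, fun i => GeomDuration.map_eq_unitUniform (hunif i), hindep, hNX,
      GeomDuration.measure_lt_of_geometric hq0 hq1 hN hgeom⟩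
  refine ⟨fun hp x₀ hx₀ => ?_, fun hp => ?_⟩
  · have hlevel : 1 - q * x₀ = Real.exp 1 * (1 - q) := by rw [hx₀]; field_simp; ring
    have h0 : 0 ≤ x₀ := GeomDuration.level_nonneg hq0 hlevel hp
    have h1 : x₀ < 1 := GeomDuration.level_lt_one hq0 hq1 hlevel
    have hmem : x₀ ∈ Set.Icc (0 : ℝ) 1 := ⟨h0, h1.le⟩
    have hone := GeomDuration.ofReal_mul_tailDuration_eq_one hq0 hq1 hmem hlevel
    have hopt := GeomDuration.IsOptimalLevel.of_mul_tailDuration_eq_one hone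
    exact ⟨h0, h1, GeomDuration.level_pos hq0 hlevel, M.stoppingRegion_eq hQ hone fun x hx hxa =>
      GeomDuration.meanDuration_unitUniform_strictMonoOn hq0 hq1 hx hmem hxa,
      hopt.isOptimal_threshold M, (hopt.value_eq M).trans
        (GeomDuration.passageValue_unitUniform_of_level hq0 hq1 hmem hlevel)⟩
  · have hopt := GeomDuration.isOptimalLevel_zero_unitUniform hq0 hq1 hp
    have hnull : GeomDuration.unitUniform (Set.Iio 0) = 0 := by
      rw [GeomDuration.unitUniform_Iio zero_le_one, ENNReal.ofReal_zero]
    exact ⟨hopt.stoppingRegion_eq_states M hQ le_rfl, hopt.isOptimal_zero M hnull,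
      (hopt.value_eq M).trans (GeomDuration.passageValue_unitUniform_zero hq0 hq1)⟩
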